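/- Let $\mathbb K$ be a field of characteristic zero, $S=\mathbb K[x,y]$, $\alpha_1=x$, $\alpha_2=y$, $\alpha_3=x-y$, $\alpha_4=x+y$. For $m=(m_1,m_2,m_3,m_4)\in\mathbb Z_{\ge0}^4$ put $|m|=m_1+m_2+m_3+m_4$ and let $$D(m)=\{\theta\in \mathrm{Der}_{\mathbb K}(S)=S\partial_x\oplus S\partial_y \mid \theta(\alpha_i)\in\alpha_i^{m_i}S \text{ for } i=1,2,3,4\}.$$ Call $m$ balanced if $2m_i\le |m|-1$ for all $i$. For $n\ge 0$ let $(a)_n^{!!}=\prod_{k=0}^{n-1}(a+2k)$ (so $(a)_0^{!!}=1$). For $\mu=(\mu_1,\mu_2,\mu_3,\mu_3)\in\mathbb Z_{\ge0}^4$ with $\mu_1,\mu_2$ odd and $|\mu|\in4\mathbb Z$, put $d=\frac{|\mu|}2-1$ and $\theta(\mu)=f_\mu\partial_x-g_\mu\partial_y$, where $$f_\mu=\sum_{i=0}^{(d-\mu_1)/2}(-1)^i\frac{(\mu_1+\mu_2-d)^{!!}_{\frac{d-\mu_1}2-i}}{(d-\mu_1-2i)!!\,(d-2i)!!\,(2i)!!}x^{d-2i}y^{2i},$$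 $$g_\mu=\sum_{i=0}^{(d-\mu_2)/2}(-1)^{i+\mu_3}\frac{(\mu_1+\mu_2-d)^{!!}_{\frac{d-\mu_2}2-i}}{(d-\mu_2-2i)!!\,(d-2i)!!\,(2i)!!}x^{2i}y^{d-2i},$$ with $f_\mu=0$ if $d<\mu_1$ and $g_\mu=0$ if $d<\mu_2$. Let $m\in\mathbb Z_{\ge0}^4$ be balanced. In each of the following cases, provided that the quadruples at which $\theta$ is evaluated have nonnegative entries (that is, $m_1\ge1$, respectively $m_2\ge 1$, respectively $m_3\ge1$, wherever that entry is shifted by $-1$), the displayed pair is a basis of the $S$-module $D(m)$. 1. $m_3=m_4$: - $|m|\equiv0\pmod 4$, $m_1,m_2$ odd: $\theta(m)$, $\theta(m+(2,2,0,0))$. - $|m|\equiv0\pmod 4$, $m_1,m_2$ even: $x\,\theta(m+(-1,1,0,0))$, $y\,\theta(m+(1,-1,0,0))$. - $|m|\equiv1\pmod 4$, $m_1$ even, $m_2$ odd: $x\,\theta(m+(-1,0,0,0))$, $\theta(m+(1,0,1,1))$. - $|m|\equiv2\pmod 4$, $m_1,m_2$ odd: $\theta(m+(2,0,0,0))$,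 $\theta(m+(0,2,0,0))$. - $|m|\equiv2\pmod 4$, $m_1,m_2$ even: $\theta(m+(1,1,0,0))$, $xy\,\theta(m+(-1,-1,0,0))$. - $|m|\equiv3\pmod 4$, $m_1$ even, $m_2$ odd: $\theta(m+(1,0,0,0))$, $x\,\theta(m+(-1,0,1,1))$. 2. $m_3=m_4-1$: - $|m|\equiv0\pmod 4$, $m_1$ even, $m_2$ odd: $x\,\theta(m+(-1,0,1,0))$, $(x+y)\,\theta(m+(1,0,0,-1))$. - $|m|\equiv1\pmod 4$, $m_1,m_2$ odd: $(x+y)\,\theta(m+(0,0,0,-1))$, $\theta(m+(2,0,1,0))$. - $|m|\equiv2\pmod 4$, $m_1$ even, $m_2$ odd: $\theta(m+(1,0,1,0))$, $x(x+y)\,\theta(m+(-1,0,0,-1))$. - $|m|\equiv3\pmod 4$, $m_1,m_2$ odd: $\theta(m+(0,0,1,0))$, $(x-y)(x+y)^2\,\theta(m+(0,0,-1,-2))$. 3. $m_3=m_4-2$: - $|m|\equiv2\pmod 4$, $m_1,m_2$ odd: $\theta(m+(0,0,2,0))$, $(x+y)^2\,\theta(m+(0,0,0,-2))$. -/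

import Mathlib

open MvPolynomial
open scoped Nat

namespace B2Multi

/-- The derivations `Der(S)` of `S = K[x, y]` over `K`, with `x = X 0` and `y = X 1`. -/
abbrev Der (K : Type*) [Field K] : Type _ :=
  Derivation K (MvPolynomial (Fin 2) K) (MvPolynomial (Fin 2) K)

/-- The linear forms `x, y, x - y, x + y` of the Coxeter arrangement of type `B₂`. -/
noncomputable def alpha (K : Type*) [Field K] : Fin 4 → MvPolynomial (Fin 2) K :=
  ![X 0, X 1, X 0 - X 1, X 0 + X 1]

/-- The derivation module `D(m)`: all `θ ∈ Der(S)` with `θ(αᵢ) ∈ αᵢ ^ mᵢ S` for every `i`. -/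
noncomputable def D (K : Type*) [Field K] (m : Fin 4 → ℕ) :
    Submodule (MvPolynomial (Fin 2) K) (Der K) where
  carrier := {θ | ∀ i, θ (alpha K i) ∈ Ideal.span {alpha K i ^ m i}}
  add_mem' := fun {a b} ha hb i => by
    rw [Derivation.add_apply]
    exact Ideal.add_mem _ (ha i) (hb i)
  zero_mem' := fun i => by
    rw [Derivation.zero_apply]
    exact Ideal.zero_mem _
  smul_mem' := fun c a ha i => by
    rw [Derivation.smul_apply, smul_eq_mul]
    exact Ideal.mul_mem_left _ c (ha i)

/-- `(θ₁, θ₂)` is a basis of the `S`-module `D(m)`. -/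
def IsBasis {K : Type*} [Field K] (m : Fin 4 → ℕ) (θ₁ θ₂ : Der K) : Prop :=
  LinearIndependent (MvPolynomial (Fin 2) K) ![θ₁, θ₂] ∧
    Submodule.span (MvPolynomial (Fin 2) K) {θ₁, θ₂} = D K m

/-- `|m|`, the sum of the multiplicities. -/
def total (m : Fin 4 → ℕ) : ℕ := ∑ i, m i

/-- `m` is balanced: `2 mᵢ ≤ |m| - 1` for all `i`. -/
def Balanced (m : Fin 4 → ℕ) : Prop := ∀ i, 2 * m i + 1 ≤ total m

/-- The double Pochhammer symbol `a (a + 2) ⋯ (a + 2 (n - 1))`. -/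
def dps {R : Type*} [CommRing R] (a : R) : ℕ → R
  | 0 => 1
  | n + 1 => (a + 2 * (n : R)) * dps a n

/-- `d = |m| / 2 - 1`. -/
def dd (m : Fin 4 → ℕ) : ℕ := total m / 2 - 1

/-- The polynomial `f_m`, meant for `m = (m₁, m₂, m₃, m₃)` with `m₁, m₂` odd and `4 ∣ |m|`
(so that all divisions by `2` and, in the range of summation, all subtractions are exact). -/
noncomputable def f (K : Type*) [Field K] (m : Fin 4 → ℕ) : MvPolynomial (Fin 2) K :=
  if m 0 ≤ dd m then
    ∑ i ∈ Finset.range ((dd m - m 0) / 2 + 1),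
      C ((-1 : K) ^ i * dps ((m 0 : K) + (m 1 : K) - (dd m : K)) ((dd m - m 0) / 2 - i) /
          (((dd m - m 0 - 2 * i)‼ : K) * ((dd m - 2 * i)‼ : K) * ((2 * i)‼ : K))) *
        X 0 ^ (dd m - 2 * i) * X 1 ^ (2 * i)
  else 0

/-- The polynomial `g_m`, for the same `m` as `f_m`. -/
noncomputable def g (K : Type*) [Field K] (m : Fin 4 → ℕ) : MvPolynomial (Fin 2) K :=
  if m 1 ≤ dd m then
    ∑ i ∈ Finset.range ((dd m - m 1) / 2 + 1),
      C ((-1 : K) ^ (i + m 2) *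
            dps ((m 0 : K) + (m 1 : K) - (dd m : K)) ((dd m - m 1) / 2 - i) /
          (((dd m - m 1 - 2 * i)‼ : K) * ((dd m - 2 * i)‼ : K) * ((2 * i)‼ : K))) *
        X 0 ^ (2 * i) * X 1 ^ (dd m - 2 * i)
  else 0

/-- The derivation `θ_m = f_m ∂_x - g_m ∂_y`. -/
noncomputable def theta (K : Type*) [Field K] (m : Fin 4 → ℕ) : Der K :=
  f K m • pderiv 0 - g K m • pderiv 1

end B2Multi

/-!
The proof is Saito's criterion: two elements of `D(m)` form a basis as soon as the determinant of
their coefficients is nonzero of degree at most `|m|`, because `∏ αᵢ ^ mᵢ` always divides it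
(`isBasis_of_coeffDet`). In each case the degrees add up to `|m|`, so two points remain: `θ_μ` lies
in `D(μ)`, from which membership of the multiples follows, and the determinant is nonzero.

For the first, divisibility of `θ_μ(x)` by `x ^ μ₁` and of `θ_μ(y)` by `y ^ μ₂` is visible, and the
substitution `y ↦ -y` reduces the form `x + y` to `x - y`. Divisibility of `f_μ + g_μ` by
`(x - y) ^ μ₃` is the point. A form `∑ cₑ x ^ e y ^ (d - e)` is divisible by `(x - y) ^ n` exactly
if `∑ cₑ q(e) = 0` for all polynomials `q` of degree less than `n`, and it is enough to test
`q(e) = choose (e / 2) j` for `j < n` (`sub_pow_dvd_of_choose_half`). Now the coefficients of `d‼ f_μ`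
and `d‼ g_μ` are, up to sign, `choose b (N - i) * choose (d / 2) i` and
`choose b (M - i) * choose (d / 2) i`, where `N = (d - μ₁) / 2`, `M = (d - μ₂) / 2` and
`b = (d - μ₁ - μ₂) / 2`. As `b + d / 2 = N + M = μ₃ - 1`, the Chu–Vandermonde identity evaluates the
tests to `choose (d / 2) j` times `choose (N + M - j) N` and `choose (N + M - j) (M - j)`, which agree
(`Admissible.sub_pow_dvd`).

For the second, the lowest power of `x` in the determinant is looked at on the line `x = 0`, where
only extreme coefficients of `f` and `g` enter. If the two quadruples have different first entries,
a single product of two nonzero coefficients survives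
(`Admissible.coeffDet_theta_ne_zero_of_lt`). In the remaining cases the quadruples differ by
`(0, 0, 2, 2)`, and the two surviving products add up to a nonzero multiple of `(μ₃ - 1) μ₁`
(`Admissible.coeffDet_theta_ne_zero_of_shift`).
-/

namespace B2Multi

/-! ### Double Pochhammer symbols and binomial coefficients -/

section Binomial

theorem dps_succ_left {R : Type*} [CommRing R] (a : R) (n : ℕ) :
    dps a (n + 1) = a * dps (a + 2) n := by
  induction n with
  | zero => simp [dps]
  | succ n ih =>
    rw [dps, ih, dps]
    push_cast
    ring

variable {K : Type*} [Field K] [CharZero K]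

theorem doubleFactorial_cast_ne_zero (n : ℕ) : (n‼ : K) ≠ 0 :=
  Nat.cast_ne_zero.2 (Nat.doubleFactorial_pos n).ne'

theorem succ_mul_choose_succ (r : K) (n : ℕ) :
    ((n : K) + 1) * Ring.choose r (n + 1) = (r - n) * Ring.choose r n := by
  have h := Ring.choose_smul_choose r (Nat.le_add_right n 1)
  simp at h
  linear_combination h

theorem dps_eq_choose (a : K) (n : ℕ) :
    dps a n = (-1) ^ n * ((2 * n)‼ : K) * Ring.choose (-a / 2) n := by
  induction n with
  | zero => simp [dps]
  | succ n ih =>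
    have h := succ_mul_choose_succ (-a / 2) n
    rw [dps, ih, mul_add_one, Nat.doubleFactorial_add_two]
    push_cast
    linear_combination (-1) ^ n * 2 * ((2 * n)‼ : K) * h

/-- The binomial coefficient `d / 2` over `i` is `d‼ / ((d - 2 i)‼ (2 i)‼)`; for odd `d` its upper
argument is a proper half-integer. -/
theorem choose_half_mul_doubleFactorial (d i : ℕ) (h : 2 * i ≤ d) :
    Ring.choose ((d : K) / 2) i * (((d - 2 * i)‼ : K) * ((2 * i)‼ : K)) = (d‼ : K) := by
  induction i with
  | zero => simp
  | succ i ih =>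
    have h1 := succ_mul_choose_succ ((d : K) / 2) i
    rw [← ih (by omega)]
    obtain ⟨e, rfl⟩ := Nat.exists_eq_add_of_le h
    rw [show 2 * (i + 1) + e - 2 * i = e + 2 by omega, Nat.add_sub_cancel_left,
      show (2 * (i + 1))‼ = (2 * i + 2) * (2 * i)‼ from rfl, Nat.doubleFactorial_add_two]
    push_cast at h1 ⊢
    linear_combination 2 * (e‼ : K) * ((2 * i)‼ : K) * h1

/-- Up to sign and the common factor `1 / d‼`, the coefficients of `f_μ` and `g_μ` are products of
two generalized binomial coefficients with fixed upper arguments `-a / 2` and `d / 2`. -/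
theorem coeff_eq_choose (a : K) (d N i : ℕ) (hi : i ≤ N) (hN : 2 * N ≤ d) :
    dps a (N - i) / (((2 * N - 2 * i)‼ : K) * ((d - 2 * i)‼ : K) * ((2 * i)‼ : K)) =
      (-1) ^ (N - i) * Ring.choose (-a / 2) (N - i) * Ring.choose ((d : K) / 2) i / (d‼ : K) := by
  have h1 := choose_half_mul_doubleFactorial (K := K) d i (by omega)
  have hne (k : ℕ) : (k‼ : K) ≠ 0 := doubleFactorial_cast_ne_zero k
  rw [dps_eq_choose, ← Nat.mul_sub,
    div_eq_div_iff (mul_ne_zero (mul_ne_zero (hne _) (hne _)) (hne _)) (hne d), ← h1]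
  ring

theorem choose_mul_choose_sub (h : K) (i j : ℕ) :
    Ring.choose h i * Ring.choose (h - i) j = Ring.choose h j * Ring.choose (h - j) i := by
  have h1 := Ring.choose_smul_choose h (Nat.le_add_right i j)
  have h2 := Ring.choose_smul_choose h (Nat.le_add_left j i)
  rw [Nat.add_sub_cancel_left] at h1
  rw [Nat.add_sub_cancel] at h2
  rw [← h1, ← h2, Nat.choose_symm_add]

/-- The Chu–Vandermonde identity, written as a sum over a range. -/
theorem sum_choose_mul_choose (r s : K) (k : ℕ) :
    ∑ i ∈ Finset.range (k + 1), Ring.choose r (k - i) * Ring.choose s i =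
      Ring.choose (r + s) k := by
  rw [add_comm r s, Ring.add_choose_eq k (Commute.all s r),
    Finset.Nat.sum_antidiagonal_eq_sum_range_succ_mk]
  exact Finset.sum_congr rfl fun i _ => mul_comm _ _

/-- The `j`-th binomial moment in the exponents `h - i`, which are half of the exponents `d - 2 i`
of `x` in `f_μ`. -/
theorem sum_choose_moment_left (b h : K) (N j : ℕ) :
    ∑ i ∈ Finset.range (N + 1), Ring.choose b (N - i) * Ring.choose h i * Ring.choose (h - i) j =
      Ring.choose h j * Ring.choose (b + h - j) N := by
  rw [add_sub_assoc, ← sum_choose_mul_choose, Finset.mul_sum]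
  refine Finset.sum_congr rfl fun i _ => ?_
  rw [mul_assoc, choose_mul_choose_sub]
  ring

/-- The `j`-th binomial moment in the exponents `i`, which are half of the exponents `2 i` of `x`
in `g_μ`. -/
theorem sum_choose_moment_right (b h : K) (M j : ℕ) :
    ∑ i ∈ Finset.range (M + 1), Ring.choose b (M - i) * Ring.choose h i * Ring.choose (i : K) j =
      if j ≤ M then Ring.choose h j * Ring.choose (b + h - j) (M - j) else 0 := by
  have hz (i : ℕ) (hij : i < j) : Ring.choose (i : K) j = 0 := by
    rw [Ring.choose_natCast, Nat.choose_eq_zero_of_lt hij, Nat.cast_zero]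
  split_ifs with hj
  · obtain ⟨k, rfl⟩ := Nat.exists_eq_add_of_le hj
    rw [add_assoc j k 1, Finset.sum_range_add, Finset.sum_eq_zero, zero_add, add_sub_assoc,
      Nat.add_sub_cancel_left, ← sum_choose_mul_choose, Finset.mul_sum]
    · refine Finset.sum_congr rfl fun i _ => ?_
      have h2 := Ring.choose_smul_choose h (Nat.le_add_right j i)
      rw [Nat.add_sub_cancel_left, nsmul_eq_mul] at h2
      rw [Ring.choose_natCast, show j + k - (j + i) = k - i by omega]
      linear_combination Ring.choose b (k - i) * h2
    · intro i hi
      rw [hz i (Finset.mem_range.1 hi), mul_zero]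
  · refine Finset.sum_eq_zero fun i hi => ?_
    rw [hz i (by have := Finset.mem_range.1 hi; omega), mul_zero]

end Binomial

/-! ### Divisibility by a power of `x - y` -/

section Moments

variable {K : Type*} [Field K] [CharZero K]

/-- A form vanishes to order `n` along `x = y` if its binomial moments of order less than `n`
vanish: these are the coefficients of its expansion in powers of `x - y` and `y`. -/
theorem sub_pow_dvd_of_choose {ι : Type*} (s : Finset ι) (c : ι → K) (e : ι → ℕ) (d n : ℕ)
    (he : ∀ i ∈ s, e i ≤ d) (hc : ∀ k < n, ∑ i ∈ s, c i * ((e i).choose k : K) = 0) :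
    (X 0 - X 1 : MvPolynomial (Fin 2) K) ^ n ∣
      ∑ i ∈ s, C (c i) * X 0 ^ e i * X 1 ^ (d - e i) := by
  have key : ∑ i ∈ s, C (c i) * X 0 ^ e i * X 1 ^ (d - e i) =
      ∑ k ∈ Finset.range (d + 1), C (∑ i ∈ s, c i * ((e i).choose k : K)) *
        ((X 0 - X 1 : MvPolynomial (Fin 2) K) ^ k * X 1 ^ (d - k)) := by
    simp_rw [map_sum, Finset.sum_mul]
    rw [Finset.sum_comm]
    refine Finset.sum_congr rfl fun i hi => ?_
    have hX : (X 0 : MvPolynomial (Fin 2) K) = (X 0 - X 1) + X 1 := by ring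
    have hsub : Finset.range (e i + 1) ⊆ Finset.range (d + 1) :=
      Finset.range_subset_range.2 (by have := he i hi; omega)
    rw [← Finset.sum_subset hsub]
    · conv_lhs => rw [hX]
      rw [add_pow, Finset.mul_sum, Finset.sum_mul]
      refine Finset.sum_congr rfl fun k hk => ?_
      have hk' := Finset.mem_range.1 hk
      have := he i hi
      rw [show d - k = (e i - k) + (d - e i) by omega, pow_add]
      simp only [map_mul, map_natCast]
      ring
    · intro k _ hk
      rw [Nat.choose_eq_zero_of_lt (by simpa using hk)]
      simp
  rw [key]
  refine Finset.dvd_sum fun k _ => ?_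
  rcases lt_or_ge k n with h | h
  · simp [hc k h]
  · exact Dvd.dvd.mul_left (Dvd.dvd.mul_right (pow_dvd_pow _ h) _) _

/-- The polynomials `T ↦ (T / 2) (T / 2 - 1) ⋯ (T / 2 - j + 1)` of degree `j`, as a polynomial
sequence. -/
noncomputable def halfDescPochhammer (K : Type*) [Field K] [CharZero K] :
    Polynomial.Sequence K where
  elems' j := (descPochhammer K j).comp (Polynomial.C (2⁻¹ : K) * Polynomial.X)
  degree_eq' j := by
    have h2 : (Polynomial.C (2⁻¹ : K) * Polynomial.X).natDegree = 1 :=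
      Polynomial.natDegree_C_mul_X _ (by simp)
    have h1 : ((descPochhammer K j).comp (Polynomial.C (2⁻¹ : K) * Polynomial.X)).natDegree =
        j := by
      rw [Polynomial.natDegree_comp, descPochhammer_natDegree, h2, mul_one]
    rw [Polynomial.degree_eq_natDegree, h1]
    intro h0
    rw [Polynomial.comp_eq_zero_iff] at h0
    rcases h0 with h0 | h0
    · exact (monic_descPochhammer K j).ne_zero h0
    · rw [h0.2, Polynomial.natDegree_C] at h2
      exact zero_ne_one h2

theorem eval_descPochhammer (r : K) (k : ℕ) :
    (descPochhammer K k).eval r = (k ! : K) * Ring.choose r k := by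
  induction k with
  | zero => simp
  | succ k ih =>
    rw [descPochhammer_succ_eval, ih, Nat.factorial_succ]
    push_cast
    linear_combination - (k ! : K) * succ_mul_choose_succ r k

/-- The moment criterion with half the exponents. Both `choose T k` and `choose (T / 2) k`, for
`k < n`, span the polynomials in `T` of degree less than `n`, so the two families of moment
conditions are equivalent. -/
theorem sub_pow_dvd_of_choose_half {ι : Type*} (s : Finset ι) (c : ι → K) (e : ι → ℕ) (d n : ℕ)
    (he : ∀ i ∈ s, e i ≤ d)
    (hc : ∀ k < n, ∑ i ∈ s, c i * Ring.choose ((e i : K) / 2) k = 0) :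
    (X 0 - X 1 : MvPolynomial (Fin 2) K) ^ n ∣
      ∑ i ∈ s, C (c i) * X 0 ^ e i * X 1 ^ (d - e i) := by
  refine sub_pow_dvd_of_choose s c e d n he fun k hk => ?_
  let ev : Polynomial K →ₗ[K] K := ∑ i ∈ s, c i • Polynomial.leval (e i : K)
  have h_ev (p : Polynomial K) : ev p = ∑ i ∈ s, c i * p.eval (e i : K) := by
    simp [ev, LinearMap.sum_apply]
  have hle : Polynomial.degreeLT K n ≤ LinearMap.ker ev := by
    rw [← (halfDescPochhammer K).span_degreeLT fun i _ =>
      (Polynomial.leadingCoeff_ne_zero.2 ((halfDescPochhammer K).ne_zero i)).isUnit,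
      Submodule.span_le]
    rintro _ ⟨j, hj, rfl⟩
    have h := hc j hj
    change ev _ = 0
    have he (x : K) : ((halfDescPochhammer K) j).eval x = (j ! : K) * Ring.choose (x / 2) j := by
      change ((descPochhammer K j).comp _).eval x = _
      rw [Polynomial.eval_comp, eval_descPochhammer]
      simp [div_eq_inv_mul]
    simp_rw [h_ev, he]
    rw [← mul_zero (j ! : K), ← h, Finset.mul_sum]
    exact Finset.sum_congr rfl fun i _ => by ring
  have hmem : descPochhammer K k ∈ Polynomial.degreeLT K n := by
    rw [Polynomial.mem_degreeLT, Polynomial.degree_eq_natDegree (monic_descPochhammer K k).ne_zero,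
      descPochhammer_natDegree]
    exact_mod_cast hk
  have h := hle hmem
  rw [LinearMap.mem_ker, h_ev] at h
  simp_rw [eval_descPochhammer, Ring.choose_natCast] at h
  have hf : (k ! : K) ≠ 0 := Nat.cast_ne_zero.2 k.factorial_ne_zero
  refine (mul_eq_zero.1 (?_ : (k ! : K) * _ = 0)).resolve_left hf
  rw [← h, Finset.mul_sum]
  exact Finset.sum_congr rfl fun i _ => by ring

end Moments

/-! ### Saito's criterion -/

section Saito

variable {K : Type*} [Field K]

theorem isRelPrime_X_X : IsRelPrime (X 0 : MvPolynomial (Fin 2) K) (X 1) := by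
  have h : Irreducible (X 0 : MvPolynomial (Fin 2) K) := X_prime.irreducible
  rw [h.isRelPrime_iff_not_dvd, X_dvd_X]
  simp

theorem pairwise_isRelPrime_alpha [CharZero K] :
    Pairwise (Function.onFun IsRelPrime (alpha K)) := by
  have h01 : IsRelPrime (X 0 : MvPolynomial (Fin 2) K) (X 1) := isRelPrime_X_X
  have h02 : IsRelPrime (X 0 : MvPolynomial (Fin 2) K) (X 0 - X 1) :=
    fun p h h' => h01 h (by simpa using dvd_sub h h')
  have h03 : IsRelPrime (X 0 : MvPolynomial (Fin 2) K) (X 0 + X 1) :=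
    fun p h h' => h01 h (by simpa using dvd_sub h' h)
  have h12 : IsRelPrime (X 1 : MvPolynomial (Fin 2) K) (X 0 - X 1) :=
    fun p h h' => h01 (by simpa using dvd_add h' h) h
  have h13 : IsRelPrime (X 1 : MvPolynomial (Fin 2) K) (X 0 + X 1) :=
    fun p h h' => h01 (by simpa using dvd_sub h' h) h
  have h23 : IsRelPrime (X 0 - X 1 : MvPolynomial (Fin 2) K) (X 0 + X 1) := by
    have hC : (C (2⁻¹ : K) : MvPolynomial (Fin 2) K) * 2 = 1 := by
      rw [← map_ofNat (C : K →+* MvPolynomial (Fin 2) K) 2, ← C_mul, inv_mul_cancel₀ two_ne_zero,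
        C_1]
    refine fun p h h' => h01 ?_ ?_
    · have := (dvd_add h h').mul_left (C (2⁻¹ : K))
      convert this using 1
      linear_combination -(X 0 : MvPolynomial (Fin 2) K) * hC
    · have := (dvd_sub h' h).mul_left (C (2⁻¹ : K))
      convert this using 1
      linear_combination -(X 1 : MvPolynomial (Fin 2) K) * hC
  intro i j hij
  fin_cases i <;> fin_cases j <;>
    first
    | exact absurd rfl hij
    | assumption
    | exact IsRelPrime.symm (by assumption)

/-- The product `∏ αᵢ ^ eᵢ`, for `e = m` the defining polynomial of the multiarrangement. -/
noncomputable def formProd (K : Type*) [Field K] (e : Fin 4 → ℕ) : MvPolynomial (Fin 2) K :=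
  ∏ i, alpha K i ^ e i

theorem alpha_isHomogeneous (i : Fin 4) : (alpha K i).IsHomogeneous 1 := by
  fin_cases i
  · exact isHomogeneous_X K 0
  · exact isHomogeneous_X K 1
  · exact (isHomogeneous_X K 0).sub (isHomogeneous_X K 1)
  · exact (isHomogeneous_X K 0).add (isHomogeneous_X K 1)

theorem alpha_ne_zero (i : Fin 4) : alpha K i ≠ 0 := by
  intro h
  have h0 := congrArg (eval ![(1 : K), 0]) h
  have h1 := congrArg (eval ![(0 : K), 1]) h
  fin_cases i <;> simp [alpha] at h0 h1

theorem formProd_ne_zero (e : Fin 4 → ℕ) : formProd K e ≠ 0 :=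
  Finset.prod_ne_zero_iff.2 fun i _ => pow_ne_zero _ (alpha_ne_zero i)

theorem totalDegree_formProd (e : Fin 4 → ℕ) : (formProd K e).totalDegree = total e := by
  refine IsHomogeneous.totalDegree (IsHomogeneous.prod _ _ _ fun i _ => ?_) (formProd_ne_zero e)
  simpa using (alpha_isHomogeneous (K := K) i).pow (e i)

/-- The determinant of the coefficient matrix of `θ₁, θ₂` with respect to `∂_x, ∂_y`. -/
noncomputable def coeffDet (θ₁ θ₂ : Der K) : MvPolynomial (Fin 2) K :=
  θ₁ (X 0) * θ₂ (X 1) - θ₁ (X 1) * θ₂ (X 0)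

theorem mem_D_iff {m : Fin 4 → ℕ} {θ : Der K} :
    θ ∈ D K m ↔ ∀ i, alpha K i ^ m i ∣ θ (alpha K i) :=
  forall_congr' fun _ => Ideal.mem_span_singleton

/-- For each `i`, replacing a coordinate by `αᵢ` changes the determinant by at most a sign, and then
`αᵢ ^ mᵢ` divides a whole column; the powers for distinct `i` are relatively prime. -/
theorem formProd_dvd_coeffDet [CharZero K] {m : Fin 4 → ℕ} {θ₁ θ₂ : Der K} (h₁ : θ₁ ∈ D K m)
    (h₂ : θ₂ ∈ D K m) : formProd K m ∣ coeffDet θ₁ θ₂ := by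
  refine Fintype.prod_dvd_of_isRelPrime
    (fun i j hij => (pairwise_isRelPrime_alpha hij).pow) fun i => ?_
  obtain ⟨a, ha⟩ := mem_D_iff.1 h₁ i
  obtain ⟨b, hb⟩ := mem_D_iff.1 h₂ i
  rw [coeffDet]
  fin_cases i <;> simp [alpha] at ha hb ⊢
  · exact ⟨a * θ₂ (X 1) - θ₁ (X 1) * b, by rw [ha, hb]; ring⟩
  · exact ⟨θ₁ (X 0) * b - a * θ₂ (X 0), by rw [ha, hb]; ring⟩
  · exact ⟨a * θ₂ (X 1) - θ₁ (X 1) * b, by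
      linear_combination θ₂ (X 1) * ha - θ₁ (X 1) * hb⟩
  · exact ⟨a * θ₂ (X 1) - θ₁ (X 1) * b, by
      linear_combination θ₂ (X 1) * ha - θ₁ (X 1) * hb⟩

theorem der_ext {θ₁ θ₂ : Der K} (h0 : θ₁ (X 0) = θ₂ (X 0)) (h1 : θ₁ (X 1) = θ₂ (X 1)) :
    θ₁ = θ₂ :=
  derivation_ext fun i => by fin_cases i <;> assumption

/-- Cramer's rule. -/
theorem coeffDet_smul_eq (θ θ₁ θ₂ : Der K) :
    coeffDet θ₁ θ₂ • θ = coeffDet θ θ₂ • θ₁ + coeffDet θ₁ θ • θ₂ := by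
  apply der_ext <;> simp [coeffDet] <;> ring

/-- Saito's criterion: the determinant is a multiple of `∏ αᵢ ^ mᵢ`, by the degree bound a constant
one, and Cramer's rule then writes every element of `D(m)` in terms of `θ₁, θ₂`. -/
theorem isBasis_of_coeffDet [CharZero K] {m : Fin 4 → ℕ} {θ₁ θ₂ : Der K} (h₁ : θ₁ ∈ D K m)
    (h₂ : θ₂ ∈ D K m) (hne : coeffDet θ₁ θ₂ ≠ 0)
    (hdeg : (coeffDet θ₁ θ₂).totalDegree ≤ total m) : IsBasis m θ₁ θ₂ := by
  refine ⟨?_, le_antisymm ?_ ?_⟩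
  · rw [LinearIndependent.pair_iff]
    intro s t hst
    have e0 := congrArg (fun θ : Der K => θ (X 0)) hst
    have e1 := congrArg (fun θ : Der K => θ (X 1)) hst
    simp at e0 e1
    constructor
    · refine (mul_eq_zero.1 (?_ : s * coeffDet θ₁ θ₂ = 0)).resolve_right hne
      rw [coeffDet]
      linear_combination θ₂ (X 1) * e0 - θ₂ (X 0) * e1
    · refine (mul_eq_zero.1 (?_ : t * coeffDet θ₁ θ₂ = 0)).resolve_right hne
      rw [coeffDet]
      linear_combination θ₁ (X 0) * e1 - θ₁ (X 1) * e0
  · rw [Submodule.span_le]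
    rintro _ (rfl | rfl) <;> assumption
  · intro θ hθ
    obtain ⟨c, hc⟩ := formProd_dvd_coeffDet h₁ h₂
    obtain ⟨a, ha⟩ := formProd_dvd_coeffDet hθ h₂
    obtain ⟨b, hb⟩ := formProd_dvd_coeffDet h₁ hθ
    have hc0 : c ≠ 0 := by
      rintro rfl
      exact hne (by rw [hc, mul_zero])
    rw [hc, totalDegree_mul_of_isDomain (formProd_ne_zero m) hc0, totalDegree_formProd] at hdeg
    obtain ⟨r, rfl⟩ : ∃ r, c = C r :=
      ⟨_, totalDegree_eq_zero_iff_eq_C.1 (by omega)⟩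
    have hr : r ≠ 0 := by
      rintro rfl
      exact hc0 C_0
    have key : formProd K m • ((C r : MvPolynomial (Fin 2) K) • θ) =
        formProd K m • (a • θ₁ + b • θ₂) := by
      rw [smul_smul, ← hc, coeffDet_smul_eq, ha, hb, smul_add, smul_smul, smul_smul]
    have hθ' : θ = (C r⁻¹ * a) • θ₁ + (C r⁻¹ * b) • θ₂ := by
      have h : (C r : MvPolynomial (Fin 2) K) • θ = a • θ₁ + b • θ₂ := by
        apply der_ext
        · have := congrArg (fun θ : Der K => θ (X 0)) key
          exact mul_left_cancel₀ (formProd_ne_zero m) this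
        · have := congrArg (fun θ : Der K => θ (X 1)) key
          exact mul_left_cancel₀ (formProd_ne_zero m) this
      rw [mul_smul, mul_smul, ← smul_add, ← h, smul_smul, ← C_mul, inv_mul_cancel₀ hr, C_1,
        one_smul]
    rw [hθ', Submodule.mem_span_pair]
    exact ⟨_, _, rfl⟩

theorem IsBasis.symm {m : Fin 4 → ℕ} {θ₁ θ₂ : Der K} (h : IsBasis m θ₁ θ₂) : IsBasis m θ₂ θ₁ :=
  ⟨LinearIndependent.pair_symm_iff.1 h.1, by rw [Set.pair_comm]; exact h.2⟩

end Saito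

/-! ### The derivations `θ_μ` -/

section Theta

variable {K : Type*} [Field K]

/-- The quadruples `μ = (μ₁, μ₂, μ₃, μ₃)` with `μ₁, μ₂` odd and `4 ∣ |μ|`, for which `θ_μ` is
meant. -/
structure Admissible (μ : Fin 4 → ℕ) : Prop where
  odd_zero : Odd (μ 0)
  odd_one : Odd (μ 1)
  eq_three : μ 2 = μ 3
  total_mod : total μ % 4 = 0

theorem total_eq (m : Fin 4 → ℕ) : total m = m 0 + m 1 + m 2 + m 3 := Fin.sum_univ_four m

/-- The equation `d = |μ| / 2 - 1` without division and truncated subtraction; `μ₁, μ₂` being odd,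
`|μ| ≥ 2`. -/
theorem Admissible.two_mul_dd {μ : Fin 4 → ℕ} (h : Admissible μ) :
    2 * dd μ + 2 = μ 0 + μ 1 + 2 * μ 2 := by
  obtain ⟨⟨a, ha⟩, ⟨b, hb⟩, hc, hd⟩ := h
  rw [dd]
  rw [total_eq] at *
  omega

theorem Admissible.odd_dd {μ : Fin 4 → ℕ} (h : Admissible μ) : Odd (dd μ) := by
  have h1 := h.two_mul_dd
  obtain ⟨⟨a, ha⟩, ⟨b, hb⟩, hc, hd⟩ := h
  rw [total_eq] at hd
  rw [Nat.odd_iff]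
  omega

theorem Admissible.exists_eq_zero {μ : Fin 4 → ℕ} (h : Admissible μ) (hle : μ 0 ≤ dd μ) :
    ∃ N, dd μ = μ 0 + 2 * N := by
  obtain ⟨a, ha⟩ := h.odd_zero
  obtain ⟨b, hb⟩ := h.odd_dd
  exact ⟨b - a, by omega⟩

theorem Admissible.exists_eq_one {μ : Fin 4 → ℕ} (h : Admissible μ) (hle : μ 1 ≤ dd μ) :
    ∃ M, dd μ = μ 1 + 2 * M := by
  obtain ⟨a, ha⟩ := h.odd_one
  obtain ⟨b, hb⟩ := h.odd_dd
  exact ⟨b - a, by omega⟩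

theorem f_eq_zero {μ : Fin 4 → ℕ} (h : dd μ < μ 0) : f K μ = 0 := if_neg h.not_ge

theorem g_eq_zero {μ : Fin 4 → ℕ} (h : dd μ < μ 1) : g K μ = 0 := if_neg h.not_ge

/-- The form `∑ᵢ choose b (N - i) * choose (d / 2) i * x ^ (d - 2 i) * y ^ (2 i)`, which gives `f_μ`
and, with `x` and `y` exchanged, `g_μ`, up to constants. -/
noncomputable def binomSum [CharZero K] (b : K) (d N : ℕ) (x y : MvPolynomial (Fin 2) K) :
    MvPolynomial (Fin 2) K :=
  ∑ i ∈ Finset.range (N + 1),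
    C (Ring.choose b (N - i) * Ring.choose ((d : K) / 2) i) * x ^ (d - 2 * i) * y ^ (2 * i)

theorem f_eq_binomSum [CharZero K] {μ : Fin 4 → ℕ} {N : ℕ} (h : dd μ = μ 0 + 2 * N) :
    f K μ = C ((-1) ^ N / ((dd μ)‼ : K)) *
      binomSum (-((μ 0 : K) + μ 1 - dd μ) / 2) (dd μ) N (X 0) (X 1) := by
  rw [f, if_pos (by omega), binomSum, Finset.mul_sum, show dd μ - μ 0 = 2 * N by omega,
    Nat.mul_div_cancel_left _ two_pos]
  refine Finset.sum_congr rfl fun i hi => ?_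
  have hi' : i ≤ N := Nat.lt_succ_iff.1 (Finset.mem_range.1 hi)
  rw [mul_div_assoc, coeff_eq_choose _ _ _ _ hi' (by omega), ← mul_assoc, ← mul_assoc, ← C_mul]
  congr 3
  obtain ⟨k, rfl⟩ := Nat.exists_eq_add_of_le hi'
  rw [Nat.add_sub_cancel_left, pow_add]
  ring

theorem g_eq_binomSum [CharZero K] {μ : Fin 4 → ℕ} {M : ℕ} (h : dd μ = μ 1 + 2 * M) :
    g K μ = C ((-1) ^ (M + μ 2) / ((dd μ)‼ : K)) *
      binomSum (-((μ 0 : K) + μ 1 - dd μ) / 2) (dd μ) M (X 1) (X 0) := by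
  rw [g, if_pos (by omega), binomSum, Finset.mul_sum, show dd μ - μ 1 = 2 * M by omega,
    Nat.mul_div_cancel_left _ two_pos]
  refine Finset.sum_congr rfl fun i hi => ?_
  have hi' : i ≤ M := Nat.lt_succ_iff.1 (Finset.mem_range.1 hi)
  rw [mul_div_assoc, coeff_eq_choose _ _ _ _ hi' (by omega), mul_right_comm, ← mul_assoc,
    ← mul_assoc, ← C_mul]
  congr 3
  obtain ⟨k, rfl⟩ := Nat.exists_eq_add_of_le hi'
  rw [Nat.add_sub_cancel_left, pow_add, pow_add, pow_add]
  ring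

section Divisibility

variable [CharZero K]

theorem binomSum_moment_left (b : K) (d N j : ℕ) (hN : 2 * N ≤ d) :
    ∑ i ∈ Finset.range (N + 1), Ring.choose b (N - i) * Ring.choose ((d : K) / 2) i *
      Ring.choose (((d - 2 * i : ℕ) : K) / 2) j =
    Ring.choose ((d : K) / 2) j * Ring.choose (b + (d : K) / 2 - j) N := by
  rw [← sum_choose_moment_left]
  refine Finset.sum_congr rfl fun i hi => ?_
  have := Finset.mem_range.1 hi
  rw [Nat.cast_sub (by omega)]
  push_cast
  rw [sub_div, mul_div_cancel_left₀ _ two_ne_zero]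

theorem binomSum_moment_right (b : K) (d M j : ℕ) :
    ∑ i ∈ Finset.range (M + 1), Ring.choose b (M - i) * Ring.choose ((d : K) / 2) i *
      Ring.choose (((2 * i : ℕ) : K) / 2) j =
    if j ≤ M then Ring.choose ((d : K) / 2) j * Ring.choose (b + (d : K) / 2 - j) (M - j)
    else 0 := by
  rw [← sum_choose_moment_right]
  refine Finset.sum_congr rfl fun i _ => ?_
  push_cast
  rw [mul_div_cancel_left₀ _ two_ne_zero]

/-- With `r = b + d / 2`, this turns the right-hand side of Chu–Vandermonde in the moments into an
ordinary binomial coefficient. -/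
theorem choose_sub_natCast {n j : ℕ} (hj : j < n) {r : K} (hr : r = n - 1) (k : ℕ) :
    Ring.choose (r - j) k = ((n - 1 - j).choose k : K) := by
  rw [← Ring.choose_natCast]
  congr 1
  rw [hr, Nat.cast_sub (by omega), Nat.cast_sub (by omega), Nat.cast_one]

/-- The case where `g_μ` is zero because `d < μ₂`, and hence `N ≥ μ₃`. -/
theorem sub_pow_dvd_binomSum_left {b : K} {d N n : ℕ} (hN : 2 * N ≤ d)
    (hb : b + (d : K) / 2 = n - 1) (hn : n ≤ N) :
    (X 0 - X 1) ^ n ∣ binomSum b d N (X 0) (X 1) := by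
  have h := sub_pow_dvd_of_choose_half (Finset.range (N + 1))
    (fun i => Ring.choose b (N - i) * Ring.choose ((d : K) / 2) i) (fun i => d - 2 * i) d n
    (fun i _ => Nat.sub_le _ _) fun j hj => by
      rw [binomSum_moment_left _ _ _ _ hN, choose_sub_natCast hj hb,
        Nat.choose_eq_zero_of_lt (by omega), Nat.cast_zero, mul_zero]
  refine h.trans (dvd_of_eq (Finset.sum_congr rfl fun i hi => ?_))
  have := Finset.mem_range.1 hi
  rw [show d - (d - 2 * i) = 2 * i by omega]

/-- The case where `f_μ` is zero because `d < μ₁`, and hence `M ≥ μ₃`. -/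
theorem sub_pow_dvd_binomSum_right {b : K} {d M n : ℕ}
    (hM : 2 * M ≤ d) (hb : b + (d : K) / 2 = n - 1) (hn : n ≤ M) :
    (X 0 - X 1) ^ n ∣ binomSum b d M (X 1) (X 0) := by
  have h := sub_pow_dvd_of_choose_half (Finset.range (M + 1))
    (fun i => Ring.choose b (M - i) * Ring.choose ((d : K) / 2) i) (fun i => 2 * i) d n
    (fun i hi => by have := Finset.mem_range.1 hi; omega) fun j hj => by
      rw [binomSum_moment_right, if_pos (by omega), choose_sub_natCast hj hb,
        Nat.choose_eq_zero_of_lt (by omega), Nat.cast_zero, mul_zero]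
  refine h.trans (dvd_of_eq (Finset.sum_congr rfl fun i hi => ?_))
  exact mul_right_comm _ _ _

/-- The main case. By Chu–Vandermonde the `j`-th moments of the two sums are multiples, with the same
factor, of `choose (n - 1 - j) N` and `choose (n - 1 - j) (M - j)`, which agree as
`N + (M - j) = n - 1 - j`. -/
theorem sub_pow_dvd_binomSum_sub {b : K} {d N M n : ℕ} (hN : 2 * N ≤ d) (hM : 2 * M ≤ d)
    (hb : b + (d : K) / 2 = n - 1) (hn : N + M + 1 = n) :
    (X 0 - X 1) ^ n ∣ binomSum b d N (X 0) (X 1) - binomSum b d M (X 1) (X 0) := by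
  have h := sub_pow_dvd_of_choose_half
    ((Finset.range (N + 1)).disjSum (Finset.range (M + 1)))
    (Sum.elim (fun i => Ring.choose b (N - i) * Ring.choose ((d : K) / 2) i)
      fun i => -(Ring.choose b (M - i) * Ring.choose ((d : K) / 2) i))
    (Sum.elim (fun i => d - 2 * i) fun i => 2 * i) d n ?_ fun j hj => ?_
  · refine h.trans (dvd_of_eq ?_)
    rw [Finset.sum_disjSum, sub_eq_add_neg, binomSum, binomSum, ← Finset.sum_neg_distrib]
    congr 1 <;> refine Finset.sum_congr rfl fun i hi => ?_
    · have := Finset.mem_range.1 hi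
      simp only [Sum.elim_inl]
      rw [show d - (d - 2 * i) = 2 * i by omega]
    · simp only [Sum.elim_inr, map_neg]
      ring
  · rintro (i | i) hi
    · exact Nat.sub_le _ _
    · have := Finset.mem_range.1 (Finset.inr_mem_disjSum.1 hi)
      simp only [Sum.elim_inr]
      omega
  · rw [Finset.sum_disjSum]
    simp only [Sum.elim_inl, Sum.elim_inr, neg_mul, Finset.sum_neg_distrib]
    rw [binomSum_moment_left _ _ _ _ hN, binomSum_moment_right, choose_sub_natCast hj hb,
      choose_sub_natCast hj hb]
    split_ifs with hjM
    · rw [← Nat.choose_symm_of_eq_add (show n - 1 - j = N + (M - j) by omega), add_neg_cancel]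
    -- if `M < j`, then `n - 1 - j < N`, and both moments vanish
    · rw [Nat.choose_eq_zero_of_lt (by omega)]
      simp

theorem Admissible.sub_pow_dvd {μ : Fin 4 → ℕ} (h : Admissible μ) :
    (X 0 - X 1) ^ μ 2 ∣ f K μ + g K μ := by
  have hd := h.two_mul_dd
  have hb : -((μ 0 : K) + μ 1 - dd μ) / 2 + (dd μ : K) / 2 = (μ 2 : K) - 1 := by
    have : 2 * (dd μ : K) + 2 = μ 0 + μ 1 + 2 * μ 2 := by exact_mod_cast hd
    linear_combination this / 2
  rcases lt_or_ge (dd μ) (μ 0) with h0 | h0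
  · rw [f_eq_zero h0, zero_add]
    rcases lt_or_ge (dd μ) (μ 1) with h1 | h1
    · rw [g_eq_zero h1]
      exact dvd_zero _
    · obtain ⟨M, hM⟩ := h.exists_eq_one h1
      rw [g_eq_binomSum hM]
      exact (sub_pow_dvd_binomSum_right (by omega) hb (by omega)).mul_left _
  · obtain ⟨N, hN⟩ := h.exists_eq_zero h0
    rw [f_eq_binomSum hN]
    rcases lt_or_ge (dd μ) (μ 1) with h1 | h1
    · rw [g_eq_zero h1, add_zero]
      exact (sub_pow_dvd_binomSum_left (by omega) hb (by omega)).mul_left _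
    -- here `M + μ₃ = 2 M + 1 + N`, so that the constants of `f_μ` and `g_μ` have opposite signs
    · obtain ⟨M, hM⟩ := h.exists_eq_one h1
      have hn : N + M + 1 = μ 2 := by omega
      rw [g_eq_binomSum hM, show M + μ 2 = 2 * M + 1 + N by omega, pow_add _ _ N, pow_succ,
        pow_mul, neg_one_sq, one_pow, one_mul, neg_one_mul, neg_div _ ((-1) ^ N), map_neg, neg_mul,
        ← sub_eq_add_neg, ← mul_sub]
      exact (sub_pow_dvd_binomSum_sub (by omega) (by omega) hb hn).mul_left _

/-- The substitution `y ↦ -y` fixes `f_μ` and, `d` being odd, changes the sign of `g_μ`. -/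
theorem Admissible.add_pow_dvd {μ : Fin 4 → ℕ} (h : Admissible μ) :
    (X 0 + X 1) ^ μ 2 ∣ f K μ - g K μ := by
  let σ : MvPolynomial (Fin 2) K →ₐ[K] MvPolynomial (Fin 2) K := aeval ![X 0, -X 1]
  have hσ0 : σ (X 0) = X 0 := by simp [σ]
  have hσ1 : σ (X 1) = -X 1 := by simp [σ]
  have hf : σ (f K μ) = f K μ := by
    rw [f]
    split_ifs
    · rw [map_sum]
      refine Finset.sum_congr rfl fun i _ => ?_
      rw [map_mul, map_mul, map_pow, map_pow, hσ0, hσ1, (even_two_mul i).neg_pow]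
      congr 2
      exact σ.commutes _
    · exact map_zero σ
  have hg : σ (g K μ) = -g K μ := by
    rw [g]
    split_ifs with hle
    · rw [map_sum, ← Finset.sum_neg_distrib]
      refine Finset.sum_congr rfl fun i hi => ?_
      have hi' := Finset.mem_range.1 hi
      have hodd : Odd (dd μ - 2 * i) := by
        obtain ⟨c, hc⟩ := h.odd_dd
        obtain ⟨c', hc'⟩ := h.odd_one
        exact ⟨c - i, by omega⟩
      rw [map_mul, map_mul, map_pow, map_pow, hσ0, hσ1, hodd.neg_pow, mul_neg]
      congr 3
      exact σ.commutes _
    · rw [map_zero, neg_zero]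
  have := map_dvd σ (h.sub_pow_dvd (K := K))
  rwa [map_pow, map_sub, hσ0, hσ1, sub_neg_eq_add, map_add, hf, hg, ← sub_eq_add_neg] at this

end Divisibility

theorem X_zero_pow_dvd_f (μ : Fin 4 → ℕ) : X 0 ^ μ 0 ∣ f K μ := by
  rw [f]
  split_ifs with h
  · refine Finset.dvd_sum fun i hi => ?_
    have := Finset.mem_range.1 hi
    exact ((pow_dvd_pow _ (by omega)).mul_left _).mul_right _
  · exact dvd_zero _

theorem X_one_pow_dvd_g (μ : Fin 4 → ℕ) : X 1 ^ μ 1 ∣ g K μ := by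
  rw [g]
  split_ifs with h
  · refine Finset.dvd_sum fun i hi => ?_
    have := Finset.mem_range.1 hi
    exact (pow_dvd_pow _ (by omega)).mul_left _
  · exact dvd_zero _

@[simp]
theorem theta_X_zero (μ : Fin 4 → ℕ) : theta K μ (X 0) = f K μ := by
  simp [theta, pderiv_X]

@[simp]
theorem theta_X_one (μ : Fin 4 → ℕ) : theta K μ (X 1) = -g K μ := by
  simp [theta, pderiv_X]

theorem Admissible.theta_mem [CharZero K] {μ : Fin 4 → ℕ} (h : Admissible μ) :
    theta K μ ∈ D K μ := by
  rw [mem_D_iff]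
  intro i
  fin_cases i <;> simp [alpha]
  · exact X_zero_pow_dvd_f μ
  · exact X_one_pow_dvd_g μ
  · exact h.sub_pow_dvd
  · rw [← h.eq_three, ← sub_eq_add_neg]
    exact h.add_pow_dvd

theorem totalDegree_C_mul_X_pow_mul_X_pow_le (c : K) (a b d : ℕ) (h : a + b ≤ d) :
    (C c * X 0 ^ a * X 1 ^ b : MvPolynomial (Fin 2) K).totalDegree ≤ d := by
  refine (totalDegree_mul _ _).trans ?_
  have := totalDegree_mul (C c : MvPolynomial (Fin 2) K) (X 0 ^ a)
  rw [totalDegree_C, totalDegree_X_pow] at this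
  rw [totalDegree_X_pow]
  omega

theorem totalDegree_f_le (μ : Fin 4 → ℕ) : (f K μ).totalDegree ≤ dd μ := by
  rw [f]
  split_ifs with h
  · refine (totalDegree_finsetSum _ _).trans (Finset.sup_le fun i hi => ?_)
    have := Finset.mem_range.1 hi
    exact totalDegree_C_mul_X_pow_mul_X_pow_le _ _ _ _ (by omega)
  · simp

theorem totalDegree_g_le (μ : Fin 4 → ℕ) : (g K μ).totalDegree ≤ dd μ := by
  rw [g]
  split_ifs with h
  · refine (totalDegree_finsetSum _ _).trans (Finset.sup_le fun i hi => ?_)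
    have := Finset.mem_range.1 hi
    exact totalDegree_C_mul_X_pow_mul_X_pow_le _ _ _ _ (by omega)
  · simp

theorem totalDegree_coeffDet_theta_le (μ ν : Fin 4 → ℕ) :
    (coeffDet (theta K μ) (theta K ν)).totalDegree ≤ dd μ + dd ν := by
  rw [coeffDet]
  simp only [theta_X_zero, theta_X_one]
  refine (totalDegree_sub _ _).trans (max_le ?_ ?_) <;> refine (totalDegree_mul _ _).trans ?_ <;>
    rw [totalDegree_neg]
  · exact add_le_add (totalDegree_f_le μ) (totalDegree_g_le ν)
  · exact add_le_add (totalDegree_g_le μ) (totalDegree_f_le ν)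

/-- Saito's criterion for multiples of `θ_μ` and `θ_ν` by products of the `αᵢ`. -/
theorem isBasis_smul_theta [CharZero K] {m μ ν e e' : Fin 4 → ℕ} (hμ : Admissible μ)
    (hν : Admissible ν) (he : ∀ i, m i ≤ μ i + e i) (he' : ∀ i, m i ≤ ν i + e' i)
    (hdeg : total e + dd μ + (total e' + dd ν) ≤ total m)
    (hdet : coeffDet (theta K μ) (theta K ν) ≠ 0) :
    IsBasis m (formProd K e • theta K μ) (formProd K e' • theta K ν) := by
  have mem {ρ ε : Fin 4 → ℕ} (hρ : Admissible ρ) (hε : ∀ i, m i ≤ ρ i + ε i) :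
      formProd K ε • theta K ρ ∈ D K m := by
    refine mem_D_iff.2 fun i => ?_
    have h1 := mem_D_iff.1 (hρ.theta_mem (K := K)) i
    have h2 : alpha K i ^ ε i ∣ formProd K ε := Finset.dvd_prod_of_mem _ (Finset.mem_univ i)
    refine (pow_dvd_pow _ (hε i)).trans ?_
    rw [add_comm, pow_add]
    exact mul_dvd_mul h2 h1
  have hdet' : coeffDet (formProd K e • theta K μ) (formProd K e' • theta K ν) =
      formProd K e * formProd K e' * coeffDet (theta K μ) (theta K ν) := by
    simp only [coeffDet, Derivation.smul_apply, smul_eq_mul]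
    ring
  refine isBasis_of_coeffDet (mem hμ he) (mem hν he') ?_ ?_ <;> rw [hdet']
  · exact mul_ne_zero (mul_ne_zero (formProd_ne_zero e) (formProd_ne_zero e')) hdet
  · refine (totalDegree_mul _ _).trans ?_
    have h1 := totalDegree_mul (formProd K e) (formProd K e')
    rw [totalDegree_formProd, totalDegree_formProd] at h1
    have h2 := totalDegree_coeffDet_theta_le (K := K) μ ν
    omega

end Theta

/-! ### Nonvanishing of the determinants -/

section Nonvanishing

variable {K : Type*} [Field K]

/-- The cofactor of `x ^ μ₁` in `f_μ` at the point `(0, 1)` is the coefficient of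
`x ^ μ₁ y ^ (d - μ₁)`, the last summand. -/
theorem exists_f_eq_X_pow_mul {μ : Fin 4 → ℕ} {N : ℕ} (h : dd μ = μ 0 + 2 * N) :
    ∃ u : MvPolynomial (Fin 2) K, f K μ = X 0 ^ μ 0 * u ∧
      eval ![0, 1] u = (-1) ^ N / (((μ 0)‼ : K) * ((2 * N)‼ : K)) := by
  refine ⟨∑ i ∈ Finset.range (N + 1),
    C ((-1 : K) ^ i * dps ((μ 0 : K) + (μ 1 : K) - (dd μ : K)) (N - i) /
      (((2 * N - 2 * i)‼ : K) * ((dd μ - 2 * i)‼ : K) * ((2 * i)‼ : K))) *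
    X 0 ^ (2 * N - 2 * i) * X 1 ^ (2 * i), ?_, ?_⟩
  · rw [f, if_pos (by omega), Finset.mul_sum, show dd μ - μ 0 = 2 * N by omega,
      Nat.mul_div_cancel_left _ two_pos]
    refine Finset.sum_congr rfl fun i hi => ?_
    have := Finset.mem_range.1 hi
    rw [show dd μ - 2 * i = μ 0 + (2 * N - 2 * i) by omega, pow_add]
    ring
  · rw [Finset.sum_range_succ, map_add, map_sum, Finset.sum_eq_zero, zero_add]
    · rw [show dd μ - 2 * N = μ 0 by omega]
      simp [dps]
    · intro i hi
      have := Finset.mem_range.1 hi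
      simp [show 2 * N - 2 * i ≠ 0 by omega]

theorem eval_g {μ : Fin 4 → ℕ} {M : ℕ} (h : dd μ = μ 1 + 2 * M) :
    eval ![0, 1] (g K μ) = (-1) ^ μ 2 * dps ((μ 0 : K) + μ 1 - dd μ) M /
      (((2 * M)‼ : K) * ((dd μ)‼ : K)) := by
  rw [g, if_pos (by omega), show dd μ - μ 1 = 2 * M by omega,
      Nat.mul_div_cancel_left _ two_pos, Finset.sum_range_succ', map_add, map_sum,
      Finset.sum_eq_zero]
  · simp
  · intro i _
    simp

variable [CharZero K]

/-- All factors are odd integers, hence nonzero in characteristic zero. -/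
theorem dps_intCast_ne_zero {z : ℤ} (hz : Odd z) (n : ℕ) : dps (z : K) n ≠ 0 := by
  induction n with
  | zero => exact one_ne_zero
  | succ n ih =>
    refine mul_ne_zero ?_ ih
    have h : z + 2 * n ≠ 0 := fun h => by
      obtain ⟨k, rfl⟩ := hz
      omega
    exact_mod_cast h

theorem Admissible.dps_ne_zero {μ : Fin 4 → ℕ} (h : Admissible μ) (n : ℕ) :
    dps ((μ 0 : K) + μ 1 - dd μ) n ≠ 0 := by
  have hz : Odd ((μ 0 : ℤ) + μ 1 - dd μ) := by
    obtain ⟨a, ha⟩ := h.odd_zero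
    obtain ⟨b, hb⟩ := h.odd_one
    obtain ⟨c, hc⟩ := h.odd_dd
    exact ⟨a + b - c, by omega⟩
  have := dps_intCast_ne_zero (K := K) hz n
  push_cast at this
  exact this

theorem Admissible.eval_g_ne_zero {μ : Fin 4 → ℕ} (h : Admissible μ) (hle : μ 1 ≤ dd μ) :
    eval ![0, 1] (g K μ) ≠ 0 := by
  obtain ⟨M, hM⟩ := h.exists_eq_one hle
  rw [eval_g hM]
  exact div_ne_zero (mul_ne_zero (pow_ne_zero _ (neg_ne_zero.2 one_ne_zero)) (h.dps_ne_zero M))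
    (mul_ne_zero (doubleFactorial_cast_ne_zero _) (doubleFactorial_cast_ne_zero _))

/-- If `μ₁ < ν₁`, the coefficient of `x ^ μ₁` in the determinant comes from `f_μ g_ν` alone. -/
theorem Admissible.coeffDet_theta_ne_zero_of_lt {μ ν : Fin 4 → ℕ} (hμ : Admissible μ)
    (hν : Admissible ν) (hlt : μ 0 < ν 0) (h0 : μ 0 ≤ dd μ) (h1 : ν 1 ≤ dd ν) :
    coeffDet (theta K μ) (theta K ν) ≠ 0 := by
  obtain ⟨N, hN⟩ := hμ.exists_eq_zero h0
  obtain ⟨u, hu, hue⟩ := exists_f_eq_X_pow_mul (K := K) hN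
  obtain ⟨v, hv⟩ := X_zero_pow_dvd_f (K := K) ν
  obtain ⟨k, hk⟩ := Nat.exists_eq_add_of_lt hlt
  intro h
  have h2 : (X 0 : MvPolynomial (Fin 2) K) ^ μ 0 * (u * g K ν) =
      X 0 ^ μ 0 * (X 0 ^ (k + 1) * v * g K μ) := by
    rw [hk] at hv
    simp only [coeffDet, theta_X_zero, theta_X_one, hu, hv] at h
    linear_combination -h
  have h3 := congrArg (eval ![0, 1]) (mul_left_cancel₀ (pow_ne_zero _ (X_ne_zero 0)) h2)
  simp only [map_mul, map_pow, eval_X, Matrix.cons_val_zero, pow_succ, mul_zero, zero_mul] at h3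
  refine mul_ne_zero ?_ (hν.eval_g_ne_zero h1) h3
  rw [hue]
  exact div_ne_zero (pow_ne_zero _ (neg_ne_zero.2 one_ne_zero))
    (mul_ne_zero (doubleFactorial_cast_ne_zero _) (doubleFactorial_cast_ne_zero _))

/-- If `μ = ν + (0, 0, 2, 2)`, both products contribute to the coefficient of `x ^ μ₁` in the
determinant. With `N = (d - μ₁) / 2`, `M = (d - μ₂) / 2` and `a = μ₁ + μ₂ - d`, this coefficient is,
up to nonzero factors, `M d + N a = (μ₃ - 1) μ₁`. -/
theorem Admissible.coeffDet_theta_ne_zero_of_shift {μ ν : Fin 4 → ℕ} (hμ : Admissible μ)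
    (hν : Admissible ν) (e0 : ν 0 = μ 0) (e1 : ν 1 = μ 1) (e2 : μ 2 = ν 2 + 2)
    (h0 : μ 0 ≤ dd μ) (h1 : μ 1 ≤ dd μ) :
    coeffDet (theta K μ) (theta K ν) ≠ 0 := by
  have hdμ := hμ.two_mul_dd
  have hdν := hν.two_mul_dd
  have hd : dd μ = dd ν + 2 := by omega
  have hddf : ((dd μ)‼ : K) = dd μ * ((dd ν)‼ : K) := by
    rw [hd, Nat.doubleFactorial_add_two]
    push_cast
    ring
  obtain ⟨N, hN⟩ := hμ.exists_eq_zero h0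
  obtain ⟨M, hM⟩ := hμ.exists_eq_one h1
  obtain ⟨u, hu, hue⟩ := exists_f_eq_X_pow_mul (K := K) hN
  have hdf (k : ℕ) : (k‼ : K) ≠ 0 := doubleFactorial_cast_ne_zero k
  have hu0 : eval ![0, 1] u ≠ 0 := by
    rw [hue]
    exact div_ne_zero (pow_ne_zero _ (neg_ne_zero.2 one_ne_zero)) (mul_ne_zero (hdf _) (hdf _))
  have hg0 := hμ.eval_g_ne_zero (K := K) h1
  -- the factor `2 * N` accounts for `f_ν = 0` when `N = 0`; likewise `2 * M` for `g_ν` below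
  obtain ⟨v, hv, hve⟩ : ∃ v : MvPolynomial (Fin 2) K, f K ν = X 0 ^ μ 0 * v ∧
      eval ![0, 1] v = -(2 * N) * eval ![0, 1] u := by
    cases N with
    | zero => exact ⟨0, by rw [f_eq_zero (by omega), mul_zero], by simp⟩
    | succ N =>
      obtain ⟨v, hv, hve⟩ := exists_f_eq_X_pow_mul (K := K) (show dd ν = ν 0 + 2 * N by omega)
      refine ⟨v, by rw [hv, e0], ?_⟩
      have h2 : ((2 * (N + 1))‼ : K) = (2 * N + 2) * ((2 * N)‼ : K) := by
        rw [show (2 * (N + 1))‼ = (2 * N + 2) * (2 * N)‼ from rfl]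
        push_cast
        rfl
      have h3 : (2 * N + 2 : K) ≠ 0 := by exact_mod_cast Nat.succ_ne_zero (2 * N + 1)
      have h4 := hdf (2 * N)
      have h5 := hdf (μ 0)
      rw [hve, hue, e0, h2]
      push_cast
      field_simp
      ring
  set a : K := (μ 0 : K) + μ 1 - dd μ with ha
  have hge : a * eval ![0, 1] (g K ν) = 2 * M * dd μ * eval ![0, 1] (g K μ) := by
    cases M with
    | zero => simp [g_eq_zero (K := K) (show dd ν < ν 1 by omega)]
    | succ M =>
      have h2 : ((2 * (M + 1))‼ : K) = (2 * M + 2) * ((2 * M)‼ : K) := by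
        rw [show (2 * (M + 1))‼ = (2 * M + 2) * (2 * M)‼ from rfl]
        push_cast
        rfl
      have h3 : (2 * M + 2 : K) ≠ 0 := by exact_mod_cast Nat.succ_ne_zero (2 * M + 1)
      have h4 := hdf (2 * M)
      have h5 := hdf (dd ν)
      have h6 : (dd μ : K) ≠ 0 := by
        rw [hd]
        exact_mod_cast Nat.succ_ne_zero (dd ν + 1)
      rw [eval_g hM, eval_g (show dd ν = ν 1 + 2 * M by omega), ← ha, h2, hddf, dps_succ_left, e0,
        e1, show (μ 0 : K) + μ 1 - dd ν = a + 2 by rw [ha, hd]; push_cast; ring, e2, pow_add]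
      push_cast
      field_simp
  intro h
  have h2 : (X 0 : MvPolynomial (Fin 2) K) ^ μ 0 * (u * g K ν) =
      X 0 ^ μ 0 * (v * g K μ) := by
    simp only [coeffDet, theta_X_zero, theta_X_one, hu, hv] at h
    linear_combination -h
  have h3 := congrArg (eval ![0, 1]) (mul_left_cancel₀ (pow_ne_zero _ (X_ne_zero 0)) h2)
  rw [map_mul, map_mul, hve] at h3
  have h4 : eval ![0, 1] u * eval ![0, 1] (g K μ) * (2 * (M * dd μ + N * a)) = 0 := by
    linear_combination a * h3 - eval ![0, 1] u * hge
  have h5 : (M * dd μ + N * a : K) = ((ν 2 + 1) * μ 0 : ℕ) := by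
    have i1 : (dd μ : K) = μ 0 + 2 * N := by exact_mod_cast hN
    have i2 : (dd μ : K) = μ 1 + 2 * M := by exact_mod_cast hM
    have i3 : (N : K) + M = ν 2 + 1 := by exact_mod_cast (show N + M = ν 2 + 1 by omega)
    push_cast
    rw [ha]
    linear_combination ((M : K) + N) * i1 - N * i1 - N * i2 + μ 0 * i3
  have h6 : (ν 2 + 1) * μ 0 ≠ 0 := mul_ne_zero (Nat.succ_ne_zero _) hμ.odd_zero.pos.ne'
  refine mul_ne_zero (mul_ne_zero hu0 hg0) (mul_ne_zero two_ne_zero ?_) h4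
  rw [h5]
  exact_mod_cast h6

end Nonvanishing

/-! ### Quadruples given by their entries -/

section Entries

variable {K : Type*} [Field K]

theorem total_vec (a b c d : ℕ) : total ![a, b, c, d] = a + b + c + d := total_eq _

theorem admissible_vec {a b c c' : ℕ} (ha : a % 2 = 1) (hb : b % 2 = 1) (hc : c = c')
    (ht : (a + b + c + c') % 4 = 0) : Admissible ![a, b, c, c'] where
  odd_zero := Nat.odd_iff.2 ha
  odd_one := Nat.odd_iff.2 hb
  eq_three := hc
  total_mod := by rw [total_vec, ht]

theorem formProd_vec (p q r s : ℕ) : formProd K ![p, q, r, s] =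
    X 0 ^ p * X 1 ^ q * (X 0 - X 1) ^ r * (X 0 + X 1) ^ s :=
  Fin.prod_univ_four _

variable [CharZero K]

/-- A basis from two quadruples with different first entries. All side conditions are linear
arithmetic in the entries. -/
theorem isBasis_theta_of_lt (m : Fin 4 → ℕ) (a b c c' p q r s a₂ b₂ c₂ c₂' p₂ q₂ r₂ s₂ : ℕ)
    (adm : a % 2 = 1 ∧ b % 2 = 1 ∧ c = c' ∧ (a + b + c + c') % 4 = 0)
    (adm₂ : a₂ % 2 = 1 ∧ b₂ % 2 = 1 ∧ c₂ = c₂' ∧ (a₂ + b₂ + c₂ + c₂') % 4 = 0)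
    (hm : m 0 ≤ a + p ∧ m 1 ≤ b + q ∧ m 2 ≤ c + r ∧ m 3 ≤ c' + s)
    (hm₂ : m 0 ≤ a₂ + p₂ ∧ m 1 ≤ b₂ + q₂ ∧ m 2 ≤ c₂ + r₂ ∧ m 3 ≤ c₂' + s₂)
    (hdeg : p + q + r + s + ((a + b + c + c') / 2 - 1) +
      (p₂ + q₂ + r₂ + s₂ + ((a₂ + b₂ + c₂ + c₂') / 2 - 1)) ≤ m 0 + m 1 + m 2 + m 3)
    (hlt : a < a₂) (h0 : a ≤ (a + b + c + c') / 2 - 1)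
    (h1 : b₂ ≤ (a₂ + b₂ + c₂ + c₂') / 2 - 1) :
    IsBasis m
      ((X 0 ^ p * X 1 ^ q * (X 0 - X 1) ^ r * (X 0 + X 1) ^ s : MvPolynomial (Fin 2) K) •
        theta K ![a, b, c, c'])
      ((X 0 ^ p₂ * X 1 ^ q₂ * (X 0 - X 1) ^ r₂ * (X 0 + X 1) ^ s₂ : MvPolynomial (Fin 2) K) •
        theta K ![a₂, b₂, c₂, c₂']) := by
  have hμ := admissible_vec adm.1 adm.2.1 adm.2.2.1 adm.2.2.2
  have hν := admissible_vec adm₂.1 adm₂.2.1 adm₂.2.2.1 adm₂.2.2.2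
  rw [← formProd_vec p q r s, ← formProd_vec p₂ q₂ r₂ s₂]
  refine isBasis_smul_theta hμ hν (fun i => ?_) (fun i => ?_) ?_ ?_
  · fin_cases i
    exacts [hm.1, hm.2.1, hm.2.2.1, hm.2.2.2]
  · fin_cases i
    exacts [hm₂.1, hm₂.2.1, hm₂.2.2.1, hm₂.2.2.2]
  · rw [dd, dd, total_vec, total_vec, total_vec, total_vec, total_eq m]
    exact hdeg
  · refine hμ.coeffDet_theta_ne_zero_of_lt hν hlt ?_ ?_ <;> rw [dd, total_vec]
    exacts [h0, h1]

/-- A basis from two quadruples that differ by `(0, 0, 2, 2)`. All side conditions are linear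
arithmetic in the entries. -/
theorem isBasis_theta_of_shift (m : Fin 4 → ℕ) (a b c c' p q r s c₂ c₂' p₂ q₂ r₂ s₂ : ℕ)
    (adm : a % 2 = 1 ∧ b % 2 = 1 ∧ c = c' ∧ (a + b + c + c') % 4 = 0)
    (hc : c = c₂ + 2 ∧ c₂ = c₂')
    (hm : m 0 ≤ a + p ∧ m 1 ≤ b + q ∧ m 2 ≤ c + r ∧ m 3 ≤ c' + s)
    (hm₂ : m 0 ≤ a + p₂ ∧ m 1 ≤ b + q₂ ∧ m 2 ≤ c₂ + r₂ ∧ m 3 ≤ c₂' + s₂)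
    (hdeg : p + q + r + s + ((a + b + c + c') / 2 - 1) +
      (p₂ + q₂ + r₂ + s₂ + ((a + b + c₂ + c₂') / 2 - 1)) ≤ m 0 + m 1 + m 2 + m 3)
    (h0 : a ≤ (a + b + c + c') / 2 - 1) (h1 : b ≤ (a + b + c + c') / 2 - 1) :
    IsBasis m
      ((X 0 ^ p * X 1 ^ q * (X 0 - X 1) ^ r * (X 0 + X 1) ^ s : MvPolynomial (Fin 2) K) •
        theta K ![a, b, c, c'])
      ((X 0 ^ p₂ * X 1 ^ q₂ * (X 0 - X 1) ^ r₂ * (X 0 + X 1) ^ s₂ : MvPolynomial (Fin 2) K) •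
        theta K ![a, b, c₂, c₂']) := by
  have hμ := admissible_vec adm.1 adm.2.1 adm.2.2.1 adm.2.2.2
  have hν : Admissible ![a, b, c₂, c₂'] := admissible_vec adm.1 adm.2.1 hc.2 (by omega)
  rw [← formProd_vec p q r s, ← formProd_vec p₂ q₂ r₂ s₂]
  refine isBasis_smul_theta hμ hν (fun i => ?_) (fun i => ?_) ?_ ?_
  · fin_cases i
    exacts [hm.1, hm.2.1, hm.2.2.1, hm.2.2.2]
  · fin_cases i
    exacts [hm₂.1, hm₂.2.1, hm₂.2.2.1, hm₂.2.2.2]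
  · rw [dd, dd, total_vec, total_vec, total_vec, total_vec, total_eq m]
    exact hdeg
  · refine hμ.coeffDet_theta_ne_zero_of_shift hν rfl rfl hc.1 ?_ ?_ <;> rw [dd, total_vec]
    exacts [h0, h1]

end Entries

end B2Multi

theorem corollary3p7 (K : Type*) [Field K] [CharZero K] (m : Fin 4 → ℕ)
    (hm : B2Multi.Balanced m) :
    let x : MvPolynomial (Fin 2) K := MvPolynomial.X 0
    let y : MvPolynomial (Fin 2) K := MvPolynomial.X 1
    let θ : (Fin 4 → ℕ) → B2Multi.Der K := B2Multi.theta K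
    -- the case `m₃ = m₄`
    (m 2 = m 3 →
      (B2Multi.total m % 4 = 0 → Odd (m 0) → Odd (m 1) →
        B2Multi.IsBasis m
          (θ m)
          (θ ![m 0 + 2, m 1 + 2, m 2, m 3])) ∧
      (B2Multi.total m % 4 = 0 → Even (m 0) → Even (m 1) → 1 ≤ m 0 → 1 ≤ m 1 →
        B2Multi.IsBasis m
          (x • θ ![m 0 - 1, m 1 + 1, m 2, m 3])
          (y • θ ![m 0 + 1, m 1 - 1, m 2, m 3])) ∧
      (B2Multi.total m % 4 = 1 → Even (m 0) → Odd (m 1) → 1 ≤ m 0 →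
        B2Multi.IsBasis m
          (x • θ ![m 0 - 1, m 1, m 2, m 3])
          (θ ![m 0 + 1, m 1, m 2 + 1, m 3 + 1])) ∧
      (B2Multi.total m % 4 = 2 → Odd (m 0) → Odd (m 1) →
        B2Multi.IsBasis m
          (θ ![m 0 + 2, m 1, m 2, m 3])
          (θ ![m 0, m 1 + 2, m 2, m 3])) ∧
      (B2Multi.total m % 4 = 2 → Even (m 0) → Even (m 1) → 1 ≤ m 0 → 1 ≤ m 1 →
        B2Multi.IsBasis m
          (θ ![m 0 + 1, m 1 + 1, m 2, m 3])
          ((x * y) • θ ![m 0 - 1, m 1 - 1, m 2, m 3])) ∧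
      (B2Multi.total m % 4 = 3 → Even (m 0) → Odd (m 1) → 1 ≤ m 0 →
        B2Multi.IsBasis m
          (θ ![m 0 + 1, m 1, m 2, m 3])
          (x • θ ![m 0 - 1, m 1, m 2 + 1, m 3 + 1]))) ∧
    -- the case `m₃ = m₄ - 1`
    (m 2 + 1 = m 3 →
      (B2Multi.total m % 4 = 0 → Even (m 0) → Odd (m 1) → 1 ≤ m 0 →
        B2Multi.IsBasis m
          (x • θ ![m 0 - 1, m 1, m 2 + 1, m 3])
          ((x + y) • θ ![m 0 + 1, m 1, m 2, m 3 - 1])) ∧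
      (B2Multi.total m % 4 = 1 → Odd (m 0) → Odd (m 1) →
        B2Multi.IsBasis m
          ((x + y) • θ ![m 0, m 1, m 2, m 3 - 1])
          (θ ![m 0 + 2, m 1, m 2 + 1, m 3])) ∧
      (B2Multi.total m % 4 = 2 → Even (m 0) → Odd (m 1) → 1 ≤ m 0 →
        B2Multi.IsBasis m
          (θ ![m 0 + 1, m 1, m 2 + 1, m 3])
          ((x * (x + y)) • θ ![m 0 - 1, m 1, m 2, m 3 - 1])) ∧
      (B2Multi.total m % 4 = 3 → Odd (m 0) → Odd (m 1) → 1 ≤ m 2 →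
        B2Multi.IsBasis m
          (θ ![m 0, m 1, m 2 + 1, m 3])
          (((x - y) * (x + y) ^ 2) • θ ![m 0, m 1, m 2 - 1, m 3 - 2]))) ∧
    -- the case `m₃ = m₄ - 2`
    (m 2 + 2 = m 3 →
      (B2Multi.total m % 4 = 2 → Odd (m 0) → Odd (m 1) →
        B2Multi.IsBasis m
          (θ ![m 0, m 1, m 2 + 2, m 3])
          ((x + y) ^ 2 • θ ![m 0, m 1, m 2, m 3 - 2]))) := by
  intro x y θ
  have h0 := hm 0
  have h1 := hm 1
  have h2 := hm 2
  have h3 := hm 3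
  rw [B2Multi.total_eq] at h0 h1 h2 h3
  simp only [Nat.odd_iff, Nat.even_iff, B2Multi.total_eq]
  refine ⟨fun h => ⟨fun ht e0 e1 => ?_, fun ht e0 e1 p0 p1 => ?_, fun ht e0 e1 p0 => ?_,
    fun ht e0 e1 => ?_, fun ht e0 e1 p0 p1 => ?_, fun ht e0 e1 p0 => ?_⟩,
    fun h => ⟨fun ht e0 e1 p0 => ?_, fun ht e0 e1 => ?_, fun ht e0 e1 p0 => ?_,
    fun ht e0 e1 p2 => ?_⟩, fun h ht e0 e1 => ?_⟩
  -- `θ m` is not displayed with explicit entries here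
  · have hv : m = ![m 0, m 1, m 2, m 3] := by
      ext i
      fin_cases i <;> rfl
    have := B2Multi.isBasis_theta_of_lt (K := K) m (m 0) (m 1) (m 2) (m 3) 0 0 0 0
      (m 0 + 2) (m 1 + 2) (m 2) (m 3) 0 0 0 0 (by omega) (by omega) (by omega) (by omega)
      (by omega) (by omega) (by omega) (by omega)
    rw [← hv] at this
    simpa using this
  · simpa using B2Multi.isBasis_theta_of_lt (K := K) m (m 0 - 1) (m 1 + 1) (m 2) (m 3) 1 0 0 0
      (m 0 + 1) (m 1 - 1) (m 2) (m 3) 0 1 0 0 (by omega) (by omega) (by omega) (by omega)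
      (by omega) (by omega) (by omega) (by omega)
  · simpa using B2Multi.isBasis_theta_of_lt (K := K) m (m 0 - 1) (m 1) (m 2) (m 3) 1 0 0 0
      (m 0 + 1) (m 1) (m 2 + 1) (m 3 + 1) 0 0 0 0 (by omega) (by omega) (by omega) (by omega)
      (by omega) (by omega) (by omega) (by omega)
  · refine B2Multi.IsBasis.symm ?_
    simpa using B2Multi.isBasis_theta_of_lt (K := K) m (m 0) (m 1 + 2) (m 2) (m 3) 0 0 0 0
      (m 0 + 2) (m 1) (m 2) (m 3) 0 0 0 0 (by omega) (by omega) (by omega) (by omega)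
      (by omega) (by omega) (by omega) (by omega)
  · refine B2Multi.IsBasis.symm ?_
    simpa using B2Multi.isBasis_theta_of_lt (K := K) m (m 0 - 1) (m 1 - 1) (m 2) (m 3) 1 1 0 0
      (m 0 + 1) (m 1 + 1) (m 2) (m 3) 0 0 0 0 (by omega) (by omega) (by omega) (by omega)
      (by omega) (by omega) (by omega) (by omega)
  · refine B2Multi.IsBasis.symm ?_
    simpa using B2Multi.isBasis_theta_of_lt (K := K) m (m 0 - 1) (m 1) (m 2 + 1) (m 3 + 1) 1 0 0 0
      (m 0 + 1) (m 1) (m 2) (m 3) 0 0 0 0 (by omega) (by omega) (by omega) (by omega)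
      (by omega) (by omega) (by omega) (by omega)
  · simpa using B2Multi.isBasis_theta_of_lt (K := K) m (m 0 - 1) (m 1) (m 2 + 1) (m 3) 1 0 0 0
      (m 0 + 1) (m 1) (m 2) (m 3 - 1) 0 0 0 1 (by omega) (by omega) (by omega) (by omega)
      (by omega) (by omega) (by omega) (by omega)
  · simpa using B2Multi.isBasis_theta_of_lt (K := K) m (m 0) (m 1) (m 2) (m 3 - 1) 0 0 0 1
      (m 0 + 2) (m 1) (m 2 + 1) (m 3) 0 0 0 0 (by omega) (by omega) (by omega) (by omega)
      (by omega) (by omega) (by omega) (by omega)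
  · refine B2Multi.IsBasis.symm ?_
    simpa using B2Multi.isBasis_theta_of_lt (K := K) m (m 0 - 1) (m 1) (m 2) (m 3 - 1) 1 0 0 1
      (m 0 + 1) (m 1) (m 2 + 1) (m 3) 0 0 0 0 (by omega) (by omega) (by omega) (by omega)
      (by omega) (by omega) (by omega) (by omega)
  · simpa using B2Multi.isBasis_theta_of_shift (K := K) m (m 0) (m 1) (m 2 + 1) (m 3) 0 0 0 0
      (m 2 - 1) (m 3 - 2) 0 0 1 2 (by omega) (by omega) (by omega) (by omega) (by omega)
      (by omega) (by omega)
  · simpa using B2Multi.isBasis_theta_of_shift (K := K) m (m 0) (m 1) (m 2 + 2) (m 3) 0 0 0 0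
      (m 2) (m 3 - 2) 0 0 0 2 (by omega) (by omega) (by omega) (by omega) (by omega)
      (by omega) (by omega)
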